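/- Let $q>2$ be a prime power, let $K=\mathbb F_q$, and let $x_0,x_1,x_2,\dots$ be elements of an extension field of $K$ such that $x_0$ is transcendental over $K$ and $$x_{i+1}^{q-1}+(x_i+1)^{q-1}=1\qquad\text{for all } i\ge 0 .$$ For $n\ge 0$ put $F_n=K(x_0,\dots,x_n)$. A place of $F_n$ is given by a valuation ring $\mathcal O$ with $K\subseteq\mathcal O\subsetneq F_n$, and it is a zero of $z\in F_n$ if $z$ lies in the maximal ideal of $\mathcal O$. Let $n\ge 0$ and $t$ be integers with $-1\le t<n$, let $\alpha\in\mathbb F_q^*\setminus\{-1\}$, and let $Q$ be a place of $F_n$ that is a zero of $x_{t+1}-\alpha$. (i) If $n<2t+2$, then $Q$ is unramified in $F_{n+1}$, i.e. every place of $F_{n+1}$ lying over $Q$ has ramification index $1$ over $Q$. (ii) If $n\ge 2t+2$, then $Q$ is ramified in $F_{n+1}$ (some place of $F_{n+1}$ over $Q$ has ramification index greater than $1$), and every place of $F_{n+1}$ lying over $Q$ has ramification index $q-1$ over $Q$. -/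

import Mathlib

/-- A place of a field `F` over a constant field `K`, given by its valuation ring: a valuation
ring of `F` that contains the image of `K` and is different from `F`. -/
structure Place (K F : Type*) [Field K] [Field F] [Algebra K F] where
  /-- the valuation ring of the place -/
  ring : ValuationSubring F
  algebraMap_mem : ∀ c : K, algebraMap K F c ∈ ring
  ne_top : ring ≠ ⊤

namespace Place

variable {K F F' : Type*} [Field K] [Field F] [Field F'] [Algebra K F] [Algebra K F']

/-- `Q` is a zero of `z`: the function `z` lies in the maximal ideal of the valuation ring of `Q`,
that is, `z` has positive order at `Q` (in Mathlib's multiplicative notation, valuation `< 1`). -/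
def IsZero (Q : Place K F) (z : F) : Prop :=
  Q.ring.valuation z < 1

/-- The place `Q'` of the extension field `F'` lies over the place `Q` of `F`:
the valuation ring of `Q` is the intersection of that of `Q'` with `F`. -/
def LiesOver (f : F →ₐ[K] F') (Q' : Place K F') (Q : Place K F) : Prop :=
  Q'.ring.comap (f : F →+* F') = Q.ring

/-- The ramification index of `Q'` in the extension `F' / F`: the index
`[v'(F'ˣ) : v'(Fˣ)]` of the value group of the restriction to `F` of the valuation `v'` of `Q'`
in the value group of `v'`.  When `Q'` lies over `Q` and both are discrete, with normalized
valuations `ord'` and `ord`, this is the number `e ≥ 1` with `ord' (f z) = e * ord z` for all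
nonzero `z` in `F`. -/
noncomputable def ramificationIndex (f : F →ₐ[K] F') (Q' : Place K F') : ℕ :=
  (((Units.map (Q'.ring.valuation : F' →* Q'.ring.ValueGroup)).comp
    (Units.map (f : F →* F'))).range).index

/-- `Q` is unramified in `F'`: every place over `Q` has ramification index `1`. -/
def IsUnramifiedIn (f : F →ₐ[K] F') (Q : Place K F) : Prop :=
  ∀ Q' : Place K F', LiesOver f Q' Q → ramificationIndex f Q' = 1

/-- `Q` is ramified in `F'`: some place over `Q` has ramification index greater than `1`. -/
def IsRamifiedIn (f : F →ₐ[K] F') (Q : Place K F) : Prop :=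
  ∃ Q' : Place K F', LiesOver f Q' Q ∧ 1 < ramificationIndex f Q'

end Place

namespace KummerTower

/-- The sequence `x₀, x₁, x₂, …` generating the tower over `K = 𝔽_q`: the element `x₀` is
transcendental over `K` and `x_{i+1}^(q-1) + (x_i + 1)^(q-1) = 1` for all `i`. -/
structure IsGeneratingSequence (K : Type*) {E : Type*} [Field K] [Field E] [Algebra K E]
    (x : ℕ → E) : Prop where
  transcendental : Transcendental K (x 0)
  relation : ∀ i : ℕ, x (i + 1) ^ (Nat.card K - 1) + (x i + 1) ^ (Nat.card K - 1) = 1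

/-- The function field `F_n = K(x₀, …, x_n)`. -/
def level (K : Type*) {E : Type*} [Field K] [Field E] [Algebra K E] (x : ℕ → E) (n : ℕ) :
    IntermediateField K E :=
  IntermediateField.adjoin K (x '' Set.Iic n)

/-- The generator `x_i` as an element of `F_n`, for `i ≤ n`. -/
def gen (K : Type*) {E : Type*} [Field K] [Field E] [Algebra K E] (x : ℕ → E) {n i : ℕ}
    (h : i ≤ n) : level K x n :=
  ⟨x i, IntermediateField.subset_adjoin K _ ⟨i, h, rfl⟩⟩

/-- The inclusion of `F_n` in `F_{n+1}`. -/
def step (K : Type*) {E : Type*} [Field K] [Field E] [Algebra K E] (x : ℕ → E) (n : ℕ) :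
    level K x n →ₐ[K] level K x (n + 1) :=
  IntermediateField.inclusion (IntermediateField.adjoin.mono K _ _
    (Set.image_mono (Set.Iic_subset_Iic.mpr n.le_succ)))

end KummerTower

/-!
Extend a place over `Q` to a valuation `v` of the ambient field and put `T = t + 1`. For
`β ∈ 𝔽_q^*` the polynomial `1 - y ^ (q - 1)` has a simple zero at `β`. Hence the relation of the
tower forces the residue classes `-1, …, -1, α, 0, 0, …` of `x₀, x₁, …`, with `α` at index `T`,
and the values of the differences `cⱼ = xⱼ - residue` satisfy `v cⱼ ^ (q - 1) = v cⱼ₊₁` for `j < T`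
and `v cⱼ₊₁ ^ (q - 1) = v cⱼ` for `j ≥ T`. They are therefore symmetric about `T`. At level `0` the
element `c₀` is a local parameter. Up to level `2 T` every `xⱼ₊₁` has the value of some power of
`c₀`, so each step adjoins a `(q - 1)`-st root of a unit and is unramified. As `v c_{2T} = v c₀`,
from then on each step adjoins a `(q - 1)`-st root of an element with the value of a local
parameter, and is totally ramified.
-/

open IntermediateField

section Valuation

open Polynomial

theorem exists_mem_valuation_sum_eq {R Γ₀ ι : Type*} [Ring R]
    [LinearOrderedCommMonoidWithZero Γ₀] (v : Valuation R Γ₀) {s : Finset ι} (hs : s.Nonempty)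
    {f : ι → R} (hf : Set.InjOn (fun i => v (f i)) s) :
    ∃ i ∈ s, v (∑ j ∈ s, f j) = v (f i) := by
  classical
  obtain ⟨i, hi, hmax⟩ := s.exists_max_image (fun i => v (f i)) hs
  refine ⟨i, hi, v.map_sum_eq_of_lt hi fun j hj => ?_⟩
  obtain ⟨hjs, hji⟩ := Finset.mem_sdiff.mp hj
  exact (hmax j hjs).lt_of_ne fun h => hji (Finset.mem_singleton.mpr (hf hjs hi h))

theorem exists_mem_support_valuation_aeval_eq {R E Γ₀ : Type*} [CommRing R] [Ring E] [Algebra R E]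
    [LinearOrderedCommMonoidWithZero Γ₀] (v : Valuation E Γ₀) {w : E} {P : R[X]} (hP : P ≠ 0)
    (h : Set.InjOn (fun i => v (algebraMap R E (P.coeff i)) * v w ^ i) P.support) :
    ∃ i ∈ P.support, v (aeval w P) = v (algebraMap R E (P.coeff i)) * v w ^ i := by
  simp only [← map_pow, ← map_mul] at h ⊢
  rw [aeval_def, eval₂_eq_sum]
  exact exists_mem_valuation_sum_eq v (support_nonempty.mpr hP) h

end Valuation

section FormallyUnramified

open Polynomial in
theorem formallyUnramified_adjoin_singleton_of_separable {R S : Type*} [CommRing R] [CommRing S]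
    [Algebra R S] {f : R[X]} (hf : f.Separable) {w : S} (hw : aeval w f = 0) :
    Algebra.FormallyUnramified R (Algebra.adjoin R {w}) := by
  refine (Algebra.FormallyUnramified.iff_comp_injective).mpr fun B _ _ I hI g₁ g₂ hg => ?_
  let w' : Algebra.adjoin R {w} := ⟨w, Algebra.self_mem_adjoin_singleton R w⟩
  have hroot (g : Algebra.adjoin R {w} →ₐ[R] B) : aeval (g w') f = 0 := by
    rw [aeval_algHom_apply, show aeval w' f = 0 from Subtype.ext (by simpa [w'] using hw), map_zero]
  have hsimple : IsUnit (aeval (g₁ w') (derivative f)) := by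
    obtain ⟨a, b, hab⟩ := hf
    have h := congrArg (aeval (g₁ w')) hab
    rw [map_add, map_mul, hroot, mul_zero, zero_add, map_mul, map_one] at h
    exact IsUnit.of_mul_eq_one_right _ h
  have hnil : IsNilpotent (g₁ w' - g₂ w') :=
    ⟨2, Ideal.mem_bot.mp (hI ▸ Ideal.pow_mem_pow
      (Ideal.Quotient.eq.mp (DFunLike.congr_fun hg w')) 2)⟩
  refine AlgHom.adjoin_ext fun z hz => ?_
  obtain rfl := Set.mem_singleton_iff.mp hz
  -- Both lifts of `w` are simple roots of `f`, and Hensel uniqueness applies to the nilpotent `I`.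
  exact (existsUnique_nilpotent_sub_and_aeval_eq_zero (hroot g₁ ▸ IsNilpotent.zero)
    hsimple).unique ⟨by rw [sub_self]; exact .zero, hroot g₁⟩ ⟨hnil, hroot g₂⟩

variable {R A : Type*} [CommRing R] [IsLocalRing R] [CommRing A] [Algebra R A]
  [Algebra.EssFiniteType R A] [Algebra.FormallyUnramified R A] (P : Ideal A) [P.IsPrime]
  [P.LiesOver (IsLocalRing.maximalIdeal R)]

theorem map_maximalIdeal_localization_atPrime_of_formallyUnramified :
    (IsLocalRing.maximalIdeal R).map (algebraMap R (Localization.AtPrime P)) =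
      IsLocalRing.maximalIdeal (Localization.AtPrime P) := by
  have : Algebra.EssFiniteType R (Localization.AtPrime P) := .comp R A _
  have : Algebra.FormallyUnramified R (Localization.AtPrime P) := .comp R A _
  have : IsLocalHom (algebraMap R (Localization.AtPrime P)) := ⟨fun r hr => by
    by_contra h
    have hrP : algebraMap R A r ∈ P := by
      rwa [← Ideal.mem_comap, ← Ideal.under_def, ← Ideal.over_def P (IsLocalRing.maximalIdeal R),
        IsLocalRing.mem_maximalIdeal]
    rw [← IsLocalization.AtPrime.to_map_mem_maximal_iff (Localization.AtPrime P) P,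
      ← IsScalarTower.algebraMap_apply] at hrP
    exact hrP hr⟩
  exact Algebra.FormallyUnramified.map_maximalIdeal

theorem exists_mul_eq_pow_mul_of_formallyUnramified [IsNoetherianRing R] [IsDomain A] {ϖ : R}
    (hϖ : IsLocalRing.maximalIdeal R = Ideal.span {ϖ}) {a : A} (ha : a ≠ 0) :
    ∃ n : ℕ, ∃ g ∉ P, ∃ h ∉ P, a * g = algebraMap R A ϖ ^ n * h := by
  let L := Localization.AtPrime P
  have hinj : Function.Injective (algebraMap A L) :=
    IsLocalization.injective L P.primeCompl_le_nonZeroDivisors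
  have : IsDomain L := IsLocalization.isDomain_of_atPrime L P
  have : Algebra.EssFiniteType R L := .comp R A L
  have : IsNoetherianRing L := Algebra.EssFiniteType.isNoetherianRing R L
  have hmax : IsLocalRing.maximalIdeal L = Ideal.span {algebraMap R L ϖ} := by
    rw [← map_maximalIdeal_localization_atPrime_of_formallyUnramified (R := R), hϖ,
      Ideal.map_span, Set.image_singleton]
  have hnu : ¬ IsUnit (algebraMap R L ϖ) := by
    rw [← mem_nonunits_iff, ← IsLocalRing.mem_maximalIdeal, hmax]
    exact Ideal.mem_span_singleton_self _
  obtain ⟨c, hc, hndvd⟩ := (FiniteMultiplicity.of_not_isUnit hnu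
    ((map_ne_zero_iff _ hinj).mpr ha)).exists_eq_pow_mul_and_not_dvd
  obtain ⟨h, g, rfl⟩ := IsLocalization.exists_mk'_eq P.primeCompl c
  refine ⟨multiplicity (algebraMap R L ϖ) (algebraMap A L a), g, g.2, h, fun hP => hndvd ?_,
    hinj ?_⟩
  · rwa [← Ideal.mem_span_singleton, ← hmax, IsLocalization.AtPrime.mk'_mem_maximal_iff L P]
  · calc algebraMap A L (a * g)
        = algebraMap R L ϖ ^ _ * (IsLocalization.mk' L h g * algebraMap A L g) := by
          rw [map_mul, ← mul_assoc, ← hc]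
      _ = algebraMap A L (algebraMap R A ϖ ^ _ * h) := by
          rw [IsLocalization.mk'_spec, map_mul, map_pow, ← IsScalarTower.algebraMap_apply]

theorem exists_valuation_eq_pow_of_formallyUnramified {R E Γ₀ : Type*} [CommRing R]
    [IsLocalRing R] [IsNoetherianRing R] [Field E] [Algebra R E]
    [LinearOrderedCommGroupWithZero Γ₀] {v : Valuation E Γ₀} {A : Subalgebra R E}
    [Algebra.EssFiniteType R A] [Algebra.FormallyUnramified R A] {ϖ : R}
    (hϖ : IsLocalRing.maximalIdeal R = Ideal.span {ϖ}) (hA : ∀ a ∈ A, v a ≤ 1)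
    (hR : ∀ r : R, r ∈ IsLocalRing.maximalIdeal R ↔ v (algebraMap R E r) < 1) {a : E}
    (ha : a ∈ A) (ha0 : a ≠ 0) : ∃ n : ℕ, v a = v (algebraMap R E ϖ) ^ n := by
  let P : Ideal A := (IsLocalRing.maximalIdeal v.valuationSubring).comap
    (A.val.toRingHom.codRestrict v.valuationSubring.toSubring fun a => hA a a.2)
  have hP (a : A) : a ∈ P ↔ v a < 1 := Valuation.mem_maximalIdeal_iff E v
  have hP' (a : A) (h : a ∉ P) : v a = 1 :=
    (hA a a.2).antisymm (not_lt.mp ((hP a).not.mp h))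
  have : P.LiesOver (IsLocalRing.maximalIdeal R) :=
    ⟨Ideal.ext fun r => (hR r).trans (hP (algebraMap R A r)).symm⟩
  obtain ⟨n, g, hg, h, hh, hag⟩ := exists_mul_eq_pow_mul_of_formallyUnramified P hϖ
    (a := ⟨a, ha⟩) (fun h0 => ha0 (congrArg Subtype.val h0))
  have hv := congrArg (fun z : A => v z) hag
  simp only [MulMemClass.coe_mul, SubmonoidClass.coe_pow, map_mul, map_pow, hP' g hg, hP' h hh,
    mul_one] at hv
  exact ⟨n, hv⟩

end FormallyUnramified

theorem adjoin_simple_div_algebraMap {F E : Type*} [Field F] [Field E] [Algebra F E] (y : E)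
    {a : F} (ha : a ≠ 0) : F⟮y / algebraMap F E a⟯ = F⟮y⟯ := by
  refine le_antisymm (adjoin_simple_le_iff.mpr ?_) (adjoin_simple_le_iff.mpr ?_)
  · exact div_mem (mem_adjoin_simple_self F y) (F⟮y⟯.algebraMap_mem a)
  · have h := mul_mem (mem_adjoin_simple_self F (y / algebraMap F E a))
      (F⟮y / algebraMap F E a⟯.algebraMap_mem a)
    rwa [div_mul_cancel₀ y ((map_ne_zero _).mpr ha)] at h

/-- A local parameter (prime element) of the restriction of the valuation `v` of `E` to the
subfield `F`: its value generates the value group of `F`. The subfield and the parameter are kept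
inside `E` so that a single valuation serves all the fields of a tower. -/
structure IsLocalParameter {E Γ₀ : Type*} [Field E] [LinearOrderedCommGroupWithZero Γ₀]
    (v : Valuation E Γ₀) (F : Subfield E) (ϖ : E) : Prop where
  mem : ϖ ∈ F
  ne_zero : ϖ ≠ 0
  lt_one : v ϖ < 1
  exists_zpow : ∀ z ∈ F, z ≠ 0 → ∃ k : ℤ, v z = v ϖ ^ k

namespace IsLocalParameter

section Basic

variable {E Γ₀ : Type*} [Field E] [LinearOrderedCommGroupWithZero Γ₀] {v : Valuation E Γ₀}
  {F : Subfield E} {ϖ : E}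

theorem valuation_pos (h : IsLocalParameter v F ϖ) : 0 < v ϖ :=
  zero_lt_iff.mpr (v.ne_zero_iff.mpr h.ne_zero)

theorem zpow_injective (h : IsLocalParameter v F ϖ) : Function.Injective (v ϖ ^ · : ℤ → Γ₀) :=
  zpow_right_injective₀ h.valuation_pos h.lt_one.ne

theorem congr (h : IsLocalParameter v F ϖ) {ϖ' : E} (hmem : ϖ' ∈ F) (hv : v ϖ' = v ϖ) :
    IsLocalParameter v F ϖ' where
  mem := hmem
  ne_zero := by rw [← v.ne_zero_iff, hv]; exact h.valuation_pos.ne'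
  lt_one := hv ▸ h.lt_one
  exists_zpow := hv ▸ h.exists_zpow

theorem exists_pow_of_le_one (h : IsLocalParameter v F ϖ) {z : E} (hz : z ∈ F) (hz0 : z ≠ 0)
    (hz1 : v z ≤ 1) : ∃ n : ℕ, v z = v ϖ ^ n := by
  obtain ⟨k, hk⟩ := h.exists_zpow z hz hz0
  lift k to ℕ using by
    by_contra! hneg
    exact hz1.not_gt (hk ▸ one_lt_zpow_of_neg₀ h.valuation_pos h.lt_one hneg)
  exact ⟨k, by rw [hk, zpow_natCast]⟩

theorem of_comap_isEquiv {F' Γ₀' : Type*} [Field F'] [LinearOrderedCommGroupWithZero Γ₀']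
    {w : Valuation F' Γ₀'} {j : F' →+* E} (hvw : (v.comap j).IsEquiv w) {S : Subfield F'}
    {ϖ : F'} (h : IsLocalParameter v (S.map j) (j ϖ)) : IsLocalParameter w S ϖ where
  mem := by
    obtain ⟨z, hz, hzϖ⟩ := h.mem
    exact j.injective hzϖ ▸ hz
  ne_zero := (map_ne_zero j).mp h.ne_zero
  lt_one := hvw.lt_one_iff_lt_one.mp h.lt_one
  exists_zpow z hz hz0 := by
    obtain ⟨k, hk⟩ := h.exists_zpow (j z) ⟨z, hz, rfl⟩ ((map_ne_zero j).mpr hz0)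
    refine ⟨k, ?_⟩
    rw [← map_zpow₀] at hk ⊢
    rw [← map_zpow₀] at hk
    exact hvw.eq_iff.mp hk

end Basic

section Adjoin

open Polynomial

variable {F E Γ₀ : Type*} [Field F] [Field E] [Algebra F E] [LinearOrderedCommGroupWithZero Γ₀]
  {v : Valuation E Γ₀}

theorem adjoin_simple {w ϖ : E} (hmem : ϖ ∈ F⟮w⟯) (h0 : ϖ ≠ 0) (h1 : v ϖ < 1)
    (h : ∀ P : F[X], aeval w P ≠ 0 → ∃ k : ℤ, v (aeval w P) = v ϖ ^ k) :
    IsLocalParameter v F⟮w⟯.toSubfield ϖ where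
  mem := hmem
  ne_zero := h0
  lt_one := h1
  exists_zpow z hz hz0 := by
    obtain ⟨P, Q, rfl⟩ := (mem_adjoin_simple_iff F z).mp hz
    obtain ⟨hP, hQ⟩ := div_ne_zero_iff.mp hz0
    obtain ⟨k, hk⟩ := h P hP
    obtain ⟨l, hl⟩ := h Q hQ
    exact ⟨k - l, by rw [map_div₀, hk, hl, zpow_sub₀ (v.ne_zero_iff.mpr h0)]⟩

theorem adjoin_simple_of_isTrivialOn [v.IsTrivialOn F] {b : E} (h0 : b ≠ 0) (h1 : v b < 1) :
    IsLocalParameter v F⟮b⟯.toSubfield b := by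
  refine adjoin_simple (mem_adjoin_simple_self F b) h0 h1 fun P hP => ?_
  have hcoeff {i : ℕ} (hi : i ∈ P.support) : v (algebraMap F E (P.coeff i)) = 1 :=
    Valuation.IsTrivialOn.eq_one _ (mem_support_iff.mp hi)
  have hinj : Set.InjOn (fun i => v (algebraMap F E (P.coeff i)) * v b ^ i) P.support := by
    intro i hi j hj hij
    simp only [hcoeff hi, hcoeff hj, one_mul] at hij
    exact pow_right_injective₀ (zero_lt_iff.mpr (v.ne_zero_iff.mpr h0)) h1.ne hij
  obtain ⟨i, hi, hv⟩ := exists_mem_support_valuation_aeval_eq v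
    (by rintro rfl; exact hP (map_zero _)) hinj
  exact ⟨i, by rw [hv, hcoeff hi, one_mul, zpow_natCast]⟩

end Adjoin

section TotallyRamified

open Polynomial

variable {E Γ₀ : Type*} [Field E] [LinearOrderedCommGroupWithZero Γ₀] {v : Valuation E Γ₀}
  {F : Subfield E} {ϖ w : E} {m : ℕ}

theorem exists_zpow_aeval_of_degree_lt (h : IsLocalParameter v F ϖ) (hm : m ≠ 0)
    (hw : v w ^ m = v ϖ) {P : F[X]} (hP : P ≠ 0) (hdeg : P.degree < m) :
    ∃ k : ℤ, v (aeval w P) = v w ^ k := by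
  have hpos : 0 < v w := by
    rw [zero_lt_iff, ← pow_ne_zero_iff hm, hw]
    exact h.valuation_pos.ne'
  have hlt : v w < 1 := (pow_lt_one_iff hm).mp (hw ▸ h.lt_one)
  have hterm {i : ℕ} (hi : i ∈ P.support) :
      ∃ k : ℤ, v (algebraMap F E (P.coeff i)) * v w ^ i = v w ^ (m * k + i) := by
    obtain ⟨k, hk⟩ := h.exists_zpow (P.coeff i) (P.coeff i).2
      (by simpa using mem_support_iff.mp hi)
    refine ⟨k, ?_⟩
    rw [zpow_add₀ hpos.ne', zpow_mul, zpow_natCast, zpow_natCast, hw, ← hk]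
    rfl
  have hindex {i : ℕ} (hi : i ∈ P.support) : i < m :=
    Nat.cast_lt.mp ((le_degree_of_mem_supp i hi).trans_lt hdeg)
  -- The values of the monomials lie in distinct classes modulo the powers of `v ϖ`.
  have hinj : Set.InjOn (fun i => v (algebraMap F E (P.coeff i)) * v w ^ i) P.support := by
    intro i hi j hj hij
    obtain ⟨k, hk⟩ := hterm hi
    obtain ⟨l, hl⟩ := hterm hj
    have hexp : (m * k + i : ℤ) = m * l + j :=
      zpow_right_injective₀ hpos hlt.ne (hk.symm.trans (hij.trans hl))
    have hmod : (i : ℤ) ≡ j [ZMOD m] := by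
      simpa only [Int.ModEq, Int.mul_add_emod_self_left] using congrArg (· % (m : ℤ)) hexp
    exact Nat.ModEq.eq_of_lt_of_lt (Int.natCast_modEq_iff.mp hmod) (hindex hi) (hindex hj)
  obtain ⟨i, hi, hv⟩ := exists_mem_support_valuation_aeval_eq v hP hinj
  obtain ⟨k, hk⟩ := hterm hi
  exact ⟨_, hv.trans hk⟩

theorem adjoin_simple_of_pow_eq (h : IsLocalParameter v F ϖ) (hm : m ≠ 0) (hmem : w ^ m ∈ F)
    (hw : v w ^ m = v ϖ) : IsLocalParameter v F⟮w⟯.toSubfield w := by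
  have hw0 : w ≠ 0 := by
    rw [← v.ne_zero_iff, ← pow_ne_zero_iff hm, hw]
    exact h.valuation_pos.ne'
  have hw1 : v w < 1 := (pow_lt_one_iff hm).mp (hw ▸ h.lt_one)
  refine adjoin_simple (mem_adjoin_simple_self F w) hw0 hw1 fun P hP => ?_
  let f : F[X] := X ^ m - C ⟨w ^ m, hmem⟩
  have hroot : aeval w f = 0 := by
    simp only [f, map_sub, map_pow, aeval_X, aeval_C]
    exact sub_self _
  have hdeg : (P %ₘ f).degree < m :=
    (degree_modByMonic_lt P (monic_X_pow_sub_C _ hm)).trans_eq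
      (degree_X_pow_sub_C (Nat.pos_of_ne_zero hm) _)
  rw [← aeval_modByMonic_eq_self_of_root hroot] at hP ⊢
  exact h.exists_zpow_aeval_of_degree_lt hm hw (by rintro h0; exact hP (by rw [h0, map_zero])) hdeg

end TotallyRamified

section ValuationRing

variable {E Γ₀ : Type*} [Field E] [LinearOrderedCommGroupWithZero Γ₀] {v : Valuation E Γ₀}
  {F : Subfield E} {ϖ : E}

theorem exists_associated_pow (h : IsLocalParameter v F ϖ)
    {x : (v.comap F.subtype).valuationSubring} (hx : x ≠ 0) :
    ∃ n : ℕ, Associated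
      ((⟨⟨ϖ, h.mem⟩, h.lt_one.le⟩ : (v.comap F.subtype).valuationSubring) ^ n) x := by
  have hO := Valuation.valuationSubring.integers (v.comap F.subtype)
  obtain ⟨n, hn⟩ := h.exists_pow_of_le_one x.1.2 (by simpa using hx) x.2
  have hv := (map_pow (v.comap F.subtype) (⟨ϖ, h.mem⟩ : F) n).trans hn.symm
  exact ⟨n, associated_of_dvd_dvd (hO.dvd_iff_le.mpr hv.ge) (hO.dvd_iff_le.mpr hv.le)⟩

theorem irreducible (h : IsLocalParameter v F ϖ) :
    Irreducible (⟨⟨ϖ, h.mem⟩, h.lt_one.le⟩ : (v.comap F.subtype).valuationSubring) := by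
  have hO := Valuation.valuationSubring.integers (v.comap F.subtype)
  refine irreducible_iff.mpr ⟨fun hu => ?_, fun a b hab => ?_⟩
  · exact h.lt_one.ne (hO.isUnit_iff_valuation_eq_one.mp hu)
  have hmul : ϖ = a.1 * b.1 :=
    congrArg (fun z : (v.comap F.subtype).valuationSubring => (z : E)) hab
  obtain ⟨ha0, hb0⟩ := mul_ne_zero_iff.mp (hmul ▸ h.ne_zero)
  obtain ⟨i, hi⟩ := h.exists_pow_of_le_one a.1.2 ha0 a.2
  obtain ⟨j, hj⟩ := h.exists_pow_of_le_one b.1.2 hb0 b.2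
  have hij : 1 = i + j := by
    refine pow_right_injective₀ h.valuation_pos h.lt_one.ne ?_
    simp only [pow_one, pow_add, ← hi, ← hj, ← map_mul, ← hmul]
  refine Or.imp (fun hi0 => ?_) (fun hj0 => ?_) (show i = 0 ∨ j = 0 by omega)
  · exact hO.isUnit_iff_valuation_eq_one.mpr (by rw [hi0, pow_zero] at hi; exact hi)
  · exact hO.isUnit_iff_valuation_eq_one.mpr (by rw [hj0, pow_zero] at hj; exact hj)

theorem isDiscreteValuationRing (h : IsLocalParameter v F ϖ) :
    IsDiscreteValuationRing (v.comap F.subtype).valuationSubring :=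
  .ofHasUnitMulPowIrreducibleFactorization
    ⟨_, h.irreducible, fun hx => h.exists_associated_pow hx⟩

end ValuationRing

section Unramified

open Polynomial

variable {E Γ₀ : Type*} [Field E] [LinearOrderedCommGroupWithZero Γ₀] {v : Valuation E Γ₀}
  {F : Subfield E} {ϖ w y : E} {m : ℕ}

theorem adjoin_simple_of_separable (h : IsLocalParameter v F ϖ)
    {f : (v.comap F.subtype).valuationSubring[X]} (hf : f.Separable) (hroot : aeval w f = 0)
    (hw : v w ≤ 1) : IsLocalParameter v F⟮w⟯.toSubfield ϖ := by
  let O := (v.comap F.subtype).valuationSubring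
  refine adjoin_simple (F⟮w⟯.algebraMap_mem ⟨ϖ, h.mem⟩) h.ne_zero h.lt_one fun P hP => ?_
  have := h.isDiscreteValuationRing
  have : Algebra.FiniteType O (Algebra.adjoin O {w}) :=
    (Subalgebra.fg_iff_finiteType _).mp ⟨{w}, by rw [Finset.coe_singleton]⟩
  have := formallyUnramified_adjoin_singleton_of_separable hf hroot
  have hle (a : E) (ha : a ∈ Algebra.adjoin O {w}) : v a ≤ 1 := by
    induction ha using Algebra.adjoin_induction with
    | mem a ha => rwa [Set.mem_singleton_iff.mp ha]
    | algebraMap r => exact r.2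
    | add a b _ _ ha hb => exact v.map_add_le ha hb
    | mul a b _ _ ha hb => exact v.map_mul a b ▸ mul_le_one' ha hb
  obtain ⟨b, hb, hbP⟩ := IsLocalization.integerNormalization_spec (nonZeroDivisors O) P
  have hint : aeval w (IsLocalization.integerNormalization (nonZeroDivisors O) P) =
      algebraMap O E b * aeval w P := by
    rw [← aeval_map_algebraMap F, hbP, algebra_compatible_smul F b P, map_smul, Algebra.smul_def,
      ← IsScalarTower.algebraMap_apply]
  have hbE : algebraMap O E b ≠ 0 := by
    simpa using nonZeroDivisors.ne_zero hb
  obtain ⟨k, hk⟩ := h.exists_zpow (algebraMap O E b) (algebraMap O F b).2 hbE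
  obtain ⟨n, hn⟩ := exists_valuation_eq_pow_of_formallyUnramified
    h.irreducible.maximalIdeal_eq hle (fun r => Valuation.mem_maximalIdeal_iff F _)
    (aeval_mem_adjoin_singleton O w) (hint.trans_ne (mul_ne_zero hbE hP))
  refine ⟨n - k, ?_⟩
  rw [hint, map_mul, hk] at hn
  rw [zpow_sub₀ h.valuation_pos.ne', zpow_natCast,
    eq_div_iff (zpow_ne_zero _ h.valuation_pos.ne'), mul_comm]
  exact hn

theorem adjoin_simple_of_valuation_eq (h : IsLocalParameter v F ϖ) (hm : v (m : E) = 1)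
    (hmem : y ^ m ∈ F) {a : F} (ha : a ≠ 0) (hy : v y = v a) :
    IsLocalParameter v F⟮y⟯.toSubfield ϖ := by
  have hya : v (y / a) = 1 := by
    rw [map_div₀, hy, div_self (v.ne_zero_iff.mpr (by simpa using ha))]
  have hO := Valuation.valuationSubring.integers (v.comap F.subtype)
  have hu : v ((y / a) ^ m) = 1 := by
    rw [map_pow, hya, one_pow]
  have humem : (y / a) ^ m ∈ F := div_pow y (a : E) m ▸ div_mem hmem (pow_mem a.2 m)
  let u : (v.comap F.subtype).valuationSubringˣ :=
    (hO.isUnit_iff_valuation_eq_one.mpr hu : IsUnit ⟨⟨(y / a) ^ m, humem⟩, hu.le⟩).unit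
  have hmO : IsUnit (m : (v.comap F.subtype).valuationSubring) :=
    hO.isUnit_iff_valuation_eq_one.mpr hm
  rw [← adjoin_simple_div_algebraMap y ha]
  refine h.adjoin_simple_of_separable (separable_X_pow_sub_C_unit u hmO) ?_ hya.le
  rw [map_sub, map_pow, aeval_X, aeval_C]
  exact sub_self _

end Unramified

end IsLocalParameter

theorem exists_valuationSubring_comap_eq {F F' : Type*} [Field F] [Field F']
    (A : ValuationSubring F) (f : F →+* F') : ∃ B : ValuationSubring F', B.comap f = A := by
  obtain ⟨B, hB, hloc⟩ := IsLocalRing.exists_factor_valuationRing (f.comp A.subtype)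
  refine ⟨B, SetLike.ext fun z => ⟨fun hz => ?_, fun hz => hB ⟨z, hz⟩⟩⟩
  by_contra hzA
  have hz0 : z ≠ 0 := by rintro rfl; exact hzA (zero_mem A)
  have hinv : z⁻¹ ∈ A := (A.mem_or_inv_mem z).resolve_left hzA
  have hunit : IsUnit (((f.comp A.subtype).codRestrict B.toSubring hB) ⟨z⁻¹, hinv⟩) := by
    refine IsUnit.of_mul_eq_one ⟨f z, hz⟩ (Subtype.ext ?_)
    change f z⁻¹ * f z = 1
    rw [← map_mul, inv_mul_cancel₀ hz0, map_one]
  obtain ⟨c, hc⟩ := isUnit_iff_exists_inv.mp (hloc.map_nonunit _ hunit)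
  have hcz : (c : F) = z := by
    have hmul : z⁻¹ * (c : F) = 1 := congrArg Subtype.val hc
    rwa [inv_mul_eq_one₀ hz0, eq_comm] at hmul
  exact hzA (hcz ▸ c.2)

theorem comap_valuation_isEquiv {F E : Type*} [Field F] [Field E] (A : ValuationSubring E)
    (f : F →+* E) : (A.valuation.comap f).IsEquiv (A.comap f).valuation := by
  rw [Valuation.isEquiv_iff_valuationSubring, ValuationSubring.valuationSubring_valuation]
  exact SetLike.ext fun z => A.valuation_le_one_iff (f z)

theorem index_zpowers_pow {G : Type*} [Group G] [Infinite G] {g : G}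
    (hg : Subgroup.zpowers g = ⊤) (e : ℕ) : (Subgroup.zpowers (g ^ e)).index = e := by
  let φ := intEquivOfZPowersEqTop g hg
  have hφ : φ (Multiplicative.ofAdd (e : ℤ)) = g ^ e := by simp [φ]
  have hmap : Subgroup.zpowers (g ^ e) =
      (Subgroup.zpowers (Multiplicative.ofAdd (e : ℤ))).map (φ : Multiplicative ℤ →* G) :=
    hφ ▸ (MonoidHom.map_zpowers (φ : Multiplicative ℤ →* G) _).symm
  rw [hmap, Subgroup.index_map_equiv]
  exact (AddSubgroup.index_toSubgroup (AddSubgroup.zmultiples (e : ℤ))).trans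
    (Int.index_zmultiples e)

namespace Place

theorem exists_liesOver {K F F' : Type*} [Field K] [Field F] [Field F'] [Algebra K F]
    [Algebra K F'] (f : F →ₐ[K] F') (Q : Place K F) : ∃ Q' : Place K F', LiesOver f Q' Q := by
  obtain ⟨B, hB⟩ := exists_valuationSubring_comap_eq Q.ring (f : F →+* F')
  refine ⟨⟨B, fun c => ?_, ?_⟩, hB⟩
  · have hc := Q.algebraMap_mem c
    rwa [← hB, ValuationSubring.mem_comap, RingHom.coe_coe, f.commutes] at hc
  · rintro rfl
    exact Q.ne_top (hB.symm.trans (SetLike.ext fun _ => Iff.rfl))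

theorem ramificationIndex_eq {K F F' : Type*} [Field K] [Field F] [Field F'] [Algebra K F]
    [Algebra K F'] {f : F →ₐ[K] F'} {Q' : Place K F'} {ϖ ϖ' : F'} {e : ℕ}
    (h : IsLocalParameter Q'.ring.valuation (f : F →+* F').fieldRange ϖ)
    (h' : IsLocalParameter Q'.ring.valuation ⊤ ϖ')
    (he : Q'.ring.valuation ϖ = Q'.ring.valuation ϖ' ^ e) : ramificationIndex f Q' = e := by
  let g := Units.map (Q'.ring.valuation : F' →* Q'.ring.ValueGroup) (Units.mk0 ϖ' h'.ne_zero)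
  have hg (k : ℤ) : ((g ^ k : Q'.ring.ValueGroupˣ) : Q'.ring.ValueGroup) =
      Q'.ring.valuation ϖ' ^ k := Units.val_zpow_eq_zpow_val g k
  have htop : Subgroup.zpowers g = ⊤ := by
    refine (Subgroup.eq_top_iff' _).mpr fun y => ?_
    obtain ⟨z, hz⟩ := Q'.ring.valuation_surjective y
    obtain ⟨k, hk⟩ := h'.exists_zpow z trivial
      (by rintro rfl; exact y.ne_zero (by rw [← hz, map_zero]))
    exact ⟨k, Units.ext (by rw [hg, ← hk, hz])⟩
  have : Infinite Q'.ring.ValueGroupˣ := .of_injective (g ^ · : ℤ → _) fun k l hkl =>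
    h'.zpow_injective (by simpa only [hg] using congrArg Units.val hkl)
  have hrange : ((Units.map (Q'.ring.valuation : F' →* Q'.ring.ValueGroup)).comp
      (Units.map (f : F →* F'))).range = Subgroup.zpowers (g ^ e) := by
    refine le_antisymm ?_ (Subgroup.zpowers_le.mpr ?_)
    · rintro _ ⟨c, rfl⟩
      obtain ⟨k, hk⟩ := h.exists_zpow (f c) ⟨c, rfl⟩ ((map_ne_zero f).mpr c.ne_zero)
      refine ⟨k, Units.ext ?_⟩
      change ((g ^ e) ^ k : Q'.ring.ValueGroupˣ).val = _
      rw [← zpow_natCast, ← zpow_mul, hg, zpow_mul, zpow_natCast, ← he, ← hk]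
      rfl
    · obtain ⟨c, hc⟩ := h.mem
      have hc0 : c ≠ 0 := by
        rintro rfl
        exact h.ne_zero (hc.symm.trans (map_zero _))
      refine ⟨Units.mk0 c hc0, Units.ext ?_⟩
      rw [← zpow_natCast, hg, zpow_natCast, ← he, ← hc]
      rfl
  rw [ramificationIndex, hrange, index_zpowers_pow htop]

end Place

section IntermediateField

variable {K E : Type*} [Field K] [Field E] [Algebra K E] {L L' : IntermediateField K E}

theorem map_fieldRange_inclusion (hle : L ≤ L') :
    (inclusion hle : L →+* L').fieldRange.map (algebraMap L' E) = L.toSubfield := by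
  rw [RingHom.map_fieldRange]
  exact congrArg IntermediateField.toSubfield L.fieldRange_val

theorem map_top_algebraMap (L : IntermediateField K E) :
    (⊤ : Subfield L).map (algebraMap L E) = L.toSubfield := by
  rw [← RingHom.fieldRange_eq_map]
  exact congrArg IntermediateField.toSubfield L.fieldRange_val

variable (K) in
theorem adjoin_insert_toSubfield (S : Set E) (y : E) :
    (adjoin K (insert y S)).toSubfield = (adjoin K S).toSubfield⟮y⟯.toSubfield := by
  have hrange : Set.range (algebraMap (adjoin K S).toSubfield E) = (adjoin K S).toSubfield :=
    Subtype.range_coe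
  rw [adjoin_toSubfield (adjoin K S).toSubfield, hrange, Subfield.closure_union,
    Subfield.closure_eq, adjoin_toSubfield, adjoin_toSubfield, ← Subfield.closure_union,
    Set.union_assoc, Set.union_singleton]

namespace Place

variable {Q : Place K L} {Q' : Place K L'} {A : ValuationSubring E}

theorem comap_algebraMap_eq_of_liesOver (hle : L ≤ L') (hQ' : LiesOver (inclusion hle) Q' Q)
    (hA : A.comap (algebraMap L' E) = Q'.ring) : A.comap (algebraMap L E) = Q.ring := by
  rw [← hQ', ← hA]
  rfl

theorem ramificationIndex_inclusion_eq (hle : L ≤ L') (hA : A.comap (algebraMap L' E) = Q'.ring)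
    {ϖ ϖ' : E} {e : ℕ} (h : IsLocalParameter A.valuation L.toSubfield ϖ)
    (h' : IsLocalParameter A.valuation L'.toSubfield ϖ')
    (he : A.valuation ϖ = A.valuation ϖ' ^ e) : ramificationIndex (inclusion hle) Q' = e := by
  have hequiv : (A.valuation.comap (algebraMap L' E)).IsEquiv Q'.ring.valuation :=
    hA ▸ comap_valuation_isEquiv A _
  let p : L' := ⟨ϖ, hle h.mem⟩
  let p' : L' := ⟨ϖ', h'.mem⟩
  have hp : IsLocalParameter Q'.ring.valuation (inclusion hle : L →+* L').fieldRange p :=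
    .of_comap_isEquiv hequiv (by rwa [map_fieldRange_inclusion])
  have hp' : IsLocalParameter Q'.ring.valuation ⊤ p' :=
    .of_comap_isEquiv hequiv (by rwa [map_top_algebraMap])
  have hpe : A.valuation p = A.valuation (p' ^ e : L') := he.trans (map_pow _ _ _).symm
  exact ramificationIndex_eq hp hp' ((hequiv.eq_iff.mp hpe).trans (map_pow _ _ _))

end Place

end IntermediateField

namespace KummerTower

section Field

variable {K E Γ₀ : Type*} [Field K] [Field E] [Algebra K E] [LinearOrderedCommGroupWithZero Γ₀]

theorem valuation_one_sub_pow [Finite K] {v : Valuation E Γ₀} {β : K} (hβ : β ≠ 0) {y : E}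
    (hy : v (y - algebraMap K E β) < 1) :
    v (1 - y ^ (Nat.card K - 1)) = v (y - algebraMap K E β) := by
  have := Fintype.ofFinite K
  have hq : 1 < Nat.card K := Finite.one_lt_card
  have hv := FiniteField.valuation_algebraMap_eq_one v β hβ
  set δ := y - algebraMap K E β with hδ
  have hvy : v y = 1 := by
    rw [← sub_add_cancel y (algebraMap K E β), v.map_add_eq_of_lt_right (hv.symm ▸ hy), hv]
  have hvδ : v (1 - δ ^ (Nat.card K - 1)) = 1 := by
    refine v.map_one_sub_of_lt ?_
    rw [map_pow]
    exact pow_lt_one₀ zero_le hy (by omega)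
  have hfrob : δ ^ Nat.card K = y ^ Nat.card K - algebraMap K E β := by
    have h := map_sub (FiniteField.frobeniusAlgHom K E) y (algebraMap K E β)
    rw [AlgHom.commutes] at h
    simpa [Nat.card_eq_fintype_card] using h
  have hsplit (z : E) : z * (1 - z ^ (Nat.card K - 1)) = z - z ^ Nat.card K := by
    rw [mul_sub, mul_one, mul_pow_sub_one (by omega)]
  have hprod : y * (1 - y ^ (Nat.card K - 1)) = δ * (1 - δ ^ (Nat.card K - 1)) := by
    rw [hsplit, hsplit, hfrob, hδ]
    ring
  simpa only [map_mul, hvy, one_mul, hvδ, mul_one] using congrArg v hprod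

theorem natCard_sub_one_ne_zero (K : Type*) [Field K] [Finite K] : Nat.card K - 1 ≠ 0 :=
  Nat.sub_ne_zero_of_lt Finite.one_lt_card

variable (K) in
theorem valuation_natCast_card_sub_one [Finite K] (v : Valuation E Γ₀) :
    v ((Nat.card K - 1 : ℕ) : E) = 1 := by
  have := Fintype.ofFinite K
  have hq : (Nat.card K : E) = 0 := by
    rw [← map_natCast (algebraMap K E), Nat.card_eq_fintype_card, FiniteField.cast_card_eq_zero,
      map_zero]
  rw [Nat.cast_sub Nat.card_pos, hq, Nat.cast_one, zero_sub, v.map_neg, map_one]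

end Field

section Residue

variable {K E : Type*} [Field K] [Field E] [Algebra K E]

/-- The residue class of `x j` at a place that is a zero of `x T - α`. -/
def residueAt (T : ℕ) (α : K) (j : ℕ) : K :=
  if j < T then -1 else if j = T then α else 0

theorem residueAt_ne_neg_one {T : ℕ} {α : K} (hα : α ≠ -1) {j : ℕ} (hj : T ≤ j) :
    residueAt T α j ≠ -1 := by
  unfold residueAt
  split_ifs
  · omega
  · exact hα
  · exact (neg_ne_zero.mpr one_ne_zero).symm

theorem residueAt_ne_zero {T : ℕ} {α : K} (hα : α ≠ 0) {j : ℕ} (hj : j ≤ T) :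
    residueAt T α j ≠ 0 := by
  unfold residueAt
  split_ifs
  · exact neg_ne_zero.mpr one_ne_zero
  · exact hα
  · omega

/-- The function `x j` minus its residue class at a place that is a zero of `x T - α`. -/
def centered (x : ℕ → E) (T : ℕ) (α : K) (j : ℕ) : E :=
  x j - algebraMap K E (residueAt T α j)

theorem centered_of_lt (x : ℕ → E) {T : ℕ} (α : K) {j : ℕ} (hj : T < j) :
    centered x T α j = x j := by
  rw [centered, residueAt, if_neg (by omega), if_neg (by omega), map_zero, sub_zero]

theorem centered_self (x : ℕ → E) (T : ℕ) (α : K) :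
    centered x T α T = x T - algebraMap K E α := by
  rw [centered, residueAt, if_neg (lt_irrefl T), if_pos rfl]

end Residue

section Level

variable {K E : Type*} [Field K] [Field E] [Algebra K E]

variable (K) in
theorem mem_level (x : ℕ → E) {n i : ℕ} (h : i ≤ n) : x i ∈ level K x n :=
  (gen K x h).2

theorem centered_mem_level (x : ℕ → E) (T : ℕ) (α : K) {n j : ℕ} (h : j ≤ n) :
    centered x T α j ∈ level K x n :=
  sub_mem (mem_level K x h) ((level K x n).algebraMap_mem _)

theorem IsGeneratingSequence.pow_mem_level {x : ℕ → E} (hx : IsGeneratingSequence K x) (n : ℕ) :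
    x (n + 1) ^ (Nat.card K - 1) ∈ level K x n := by
  rw [eq_sub_of_add_eq (hx.relation n)]
  exact sub_mem (one_mem _) (pow_mem (add_mem (mem_level K x le_rfl) (one_mem _)) _)

theorem level_zero_eq_adjoin_centered (x : ℕ → E) (T : ℕ) (α : K) :
    level K x 0 = K⟮centered x T α 0⟯ := by
  refine le_antisymm (adjoin_le_iff.mpr ?_)
    (adjoin_simple_le_iff.mpr (centered_mem_level x T α le_rfl))
  rintro _ ⟨i, hi, rfl⟩
  obtain rfl : i = 0 := Nat.le_zero.mp hi
  rw [← sub_add_cancel (x 0) (algebraMap K E (residueAt T α 0))]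
  exact add_mem (mem_adjoin_simple_self K _) (IntermediateField.algebraMap_mem _ _)

variable (K) in
theorem level_succ_toSubfield (x : ℕ → E) (n : ℕ) :
    (level K x (n + 1)).toSubfield = (level K x n).toSubfield⟮x (n + 1)⟯.toSubfield := by
  have hIic : Set.Iic (n + 1) = insert (n + 1) (Set.Iic n) := Order.Iic_succ n
  rw [level, hIic, Set.image_insert_eq, adjoin_insert_toSubfield, ← level]

end Level

/-- The valuation `v` gives a place of the tower that is a zero of `x T - α`, where `α ≠ 0, -1`.
Triviality of `v` on the constants is no field, being automatic for the finite field `K`. -/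
structure IsZeroAt (K : Type*) {E Γ₀ : Type*} [Field K] [Field E] [Algebra K E]
    [LinearOrderedCommGroupWithZero Γ₀] (x : ℕ → E) (v : Valuation E Γ₀) (T : ℕ) (α : K) :
    Prop where
  generating : IsGeneratingSequence K x
  ne_zero : α ≠ 0
  ne_neg_one : α ≠ -1
  lt_one : v (x T - algebraMap K E α) < 1

namespace IsZeroAt

variable {K E Γ₀ : Type*} [Field K] [Field E] [Algebra K E] [LinearOrderedCommGroupWithZero Γ₀]
  {x : ℕ → E} {v : Valuation E Γ₀} {T : ℕ} {α : K}

theorem centered_zero_ne_zero (h : IsZeroAt K x v T α) : centered x T α 0 ≠ 0 := by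
  intro h0
  rw [centered, sub_eq_zero] at h0
  exact h.generating.transcendental (h0 ▸ isAlgebraic_algebraMap _)

variable [Finite K]

theorem pow_centered_of_lt (h : IsZeroAt K x v T α) {j : ℕ} (hj : j < T)
    (hlt : v (centered x T α (j + 1)) < 1) :
    v (centered x T α j) ^ (Nat.card K - 1) = v (centered x T α (j + 1)) := by
  calc v (centered x T α j) ^ (Nat.card K - 1)
      = v ((x j + 1) ^ (Nat.card K - 1)) := by
        rw [centered, residueAt, if_pos hj, map_neg, map_one, sub_neg_eq_add, map_pow]
    _ = v (1 - x (j + 1) ^ (Nat.card K - 1)) := by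
        rw [eq_sub_of_add_eq' (h.generating.relation j)]
    _ = v (centered x T α (j + 1)) :=
        valuation_one_sub_pow (residueAt_ne_zero h.ne_zero hj) hlt

theorem pow_centered_of_le (h : IsZeroAt K x v T α) {j : ℕ} (hj : T ≤ j)
    (hlt : v (centered x T α j) < 1) :
    v (centered x T α (j + 1)) ^ (Nat.card K - 1) = v (centered x T α j) := by
  have hβ : residueAt T α j + 1 ≠ 0 := fun h0 =>
    residueAt_ne_neg_one h.ne_neg_one hj (eq_neg_of_add_eq_zero_left h0)
  have hshift : x j + 1 - algebraMap K E (residueAt T α j + 1) = centered x T α j := by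
    rw [map_add, map_one, centered, add_sub_add_right_eq_sub]
  calc v (centered x T α (j + 1)) ^ (Nat.card K - 1)
      = v (x (j + 1) ^ (Nat.card K - 1)) := by
        rw [centered_of_lt x α (Nat.lt_succ_of_le hj), map_pow]
    _ = v (1 - (x j + 1) ^ (Nat.card K - 1)) := by
        rw [eq_sub_of_add_eq (h.generating.relation j)]
    _ = v (centered x T α j) := by
        rw [valuation_one_sub_pow hβ (hshift ▸ hlt), hshift]

theorem centered_lt_one (h : IsZeroAt K x v T α) (j : ℕ) : v (centered x T α j) < 1 := by
  have hm := natCard_sub_one_ne_zero K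
  rcases le_total j T with hj | hj
  · induction hj using Nat.decreasingInduction with
    | self => rw [centered_self]; exact h.lt_one
    | of_succ j hj ih => exact (pow_lt_one_iff hm).mp (h.pow_centered_of_lt hj ih ▸ ih)
  · induction j, hj using Nat.le_induction with
    | base => rw [centered_self]; exact h.lt_one
    | succ j hj ih => exact (pow_lt_one_iff hm).mp (h.pow_centered_of_le hj ih ▸ ih)

theorem valuation_centered_eq_pow (h : IsZeroAt K x v T α) {j : ℕ} (hj : j ≤ T) :
    v (centered x T α j) = v (centered x T α 0) ^ (Nat.card K - 1) ^ j := by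
  induction j with
  | zero => rw [pow_zero, pow_one]
  | succ j ih =>
    rw [← h.pow_centered_of_lt hj (h.centered_lt_one _), ih (by omega), ← pow_mul, ← pow_succ]

theorem valuation_centered_add_eq_pow (h : IsZeroAt K x v T α) {j : ℕ} (hj : j ≤ T) :
    v (centered x T α (T + j)) = v (centered x T α 0) ^ (Nat.card K - 1) ^ (T - j) := by
  induction j with
  | zero => exact h.valuation_centered_eq_pow le_rfl
  | succ j ih =>
    refine pow_left_injective (natCard_sub_one_ne_zero K) ?_
    change v (centered x T α (T + j + 1)) ^ _ = _ ^ _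
    rw [h.pow_centered_of_le (by omega) (h.centered_lt_one _), ih (by omega), ← pow_mul,
      ← pow_succ, show T - (j + 1) + 1 = T - j by omega]

theorem exists_valuation_eq_pow (h : IsZeroAt K x v T α) {i : ℕ} (hi : i < 2 * T) :
    ∃ M : ℕ, v (x (i + 1)) = v (centered x T α 0 ^ M) := by
  rcases lt_or_ge i T with hT | hT
  · refine ⟨0, ?_⟩
    have hres := FiniteField.valuation_algebraMap_eq_one v _ (residueAt_ne_zero h.ne_zero hT)
    rw [pow_zero, map_one, ← hres, ← sub_add_cancel (x (i + 1)) (algebraMap K E _)]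
    exact v.map_add_eq_of_lt_right (hres.symm ▸ h.centered_lt_one (i + 1))
  · obtain ⟨j, rfl⟩ := Nat.exists_eq_add_of_le hT
    refine ⟨(Nat.card K - 1) ^ (T - (j + 1)), ?_⟩
    rw [map_pow, ← h.valuation_centered_add_eq_pow (by omega), centered_of_lt x α (by omega),
      add_assoc]

theorem isLocalParameter_of_le (h : IsZeroAt K x v T α) {i : ℕ} (hi : i ≤ 2 * T) :
    IsLocalParameter v (level K x i).toSubfield (centered x T α 0) := by
  induction i with
  | zero =>
    rw [level_zero_eq_adjoin_centered x T α]
    exact .adjoin_simple_of_isTrivialOn h.centered_zero_ne_zero (h.centered_lt_one 0)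
  | succ i ih =>
    obtain ⟨M, hM⟩ := h.exists_valuation_eq_pow hi
    rw [level_succ_toSubfield]
    let a : (level K x i).toSubfield :=
      ⟨centered x T α 0 ^ M, pow_mem (centered_mem_level x T α (Nat.zero_le i)) M⟩
    have ha : a ≠ 0 := fun h0 =>
      pow_ne_zero M h.centered_zero_ne_zero (congrArg Subtype.val h0)
    exact (ih (by omega)).adjoin_simple_of_valuation_eq
      (valuation_natCast_card_sub_one K v) (h.generating.pow_mem_level i) ha hM

theorem isLocalParameter_of_ge (h : IsZeroAt K x v T α) {i : ℕ} (hi : 2 * T ≤ i) :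
    IsLocalParameter v (level K x i).toSubfield (centered x T α i) := by
  induction i, hi using Nat.le_induction with
  | base =>
    have hv := h.valuation_centered_add_eq_pow le_rfl
    rw [Nat.sub_self, pow_zero, pow_one, ← two_mul] at hv
    exact (h.isLocalParameter_of_le le_rfl).congr (centered_mem_level x T α le_rfl) hv
  | succ i hi ih =>
    have hpow := h.pow_centered_of_le (show T ≤ i by omega) (h.centered_lt_one i)
    rw [centered_of_lt x α (show T < i + 1 by omega)] at hpow ⊢
    rw [level_succ_toSubfield]
    exact ih.adjoin_simple_of_pow_eq (natCard_sub_one_ne_zero K) (h.generating.pow_mem_level i) hpow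

end IsZeroAt

theorem ramificationIndex_step {K E : Type*} [Field K] [Finite K] [Field E] [Algebra K E]
    {x : ℕ → E} (hx : IsGeneratingSequence K x) {n T : ℕ} (hT : T ≤ n) {α : K} (hα0 : α ≠ 0)
    (hα1 : α ≠ -1) {Q : Place K (level K x n)}
    (hQ : Q.IsZero (gen K x hT - algebraMap K (level K x n) α))
    {Q' : Place K (level K x (n + 1))} (hQ' : Place.LiesOver (step K x n) Q' Q) :
    Place.ramificationIndex (step K x n) Q' = if n < 2 * T then 1 else Nat.card K - 1 := by
  obtain ⟨A, hA⟩ := exists_valuationSubring_comap_eq Q'.ring (algebraMap (level K x (n + 1)) E)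
  have hAQ : A.comap (algebraMap (level K x n) E) = Q.ring :=
    Place.comap_algebraMap_eq_of_liesOver _ hQ' hA
  have hlt : A.valuation (x T - algebraMap K E α) < 1 :=
    (hAQ ▸ comap_valuation_isEquiv A _).lt_one_iff_lt_one.mpr hQ
  have h : IsZeroAt K x A.valuation T α := ⟨hx, hα0, hα1, hlt⟩
  split_ifs with hn
  · exact Place.ramificationIndex_inclusion_eq _ hA (h.isLocalParameter_of_le hn.le)
      (h.isLocalParameter_of_le hn) (pow_one _).symm
  · exact Place.ramificationIndex_inclusion_eq _ hA (h.isLocalParameter_of_ge (by omega))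
      (h.isLocalParameter_of_ge (by omega))
      (h.pow_centered_of_le hT (h.centered_lt_one n)).symm

end KummerTower

theorem lemma2p3 {K E : Type*} [Field K] [Field E] [Algebra K E]
    (q : ℕ) (hq : 2 < q) (hK : Nat.card K = q)
    (x : ℕ → E) (hx : KummerTower.IsGeneratingSequence K x)
    (n : ℕ) (t : ℤ) (ht : -1 ≤ t) (htn : t < n)
    (α : K) (hα0 : α ≠ 0) (hα1 : α ≠ -1)
    (Q : Place K (KummerTower.level K x n))
    (hQ : Q.IsZero (KummerTower.gen K x (i := (t + 1).toNat) (by omega)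
      - algebraMap K (KummerTower.level K x n) α)) :
    ((n : ℤ) < 2 * t + 2 → Q.IsUnramifiedIn (KummerTower.step K x n)) ∧
    (2 * t + 2 ≤ (n : ℤ) →
      Q.IsRamifiedIn (KummerTower.step K x n) ∧
      ∀ Q' : Place K (KummerTower.level K x (n + 1)),
        Place.LiesOver (KummerTower.step K x n) Q' Q →
          Place.ramificationIndex (KummerTower.step K x n) Q' = q - 1) := by
  subst hK
  have : Finite K := Nat.finite_of_card_ne_zero (by omega)
  have key := fun Q' hQ' => KummerTower.ramificationIndex_step (Q' := Q') hx
    (show (t + 1).toNat ≤ n by omega) hα0 hα1 hQ hQ'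
  refine ⟨fun hn Q' hQ' => ?_, fun hn => ?_⟩
  · rw [key Q' hQ', if_pos (by omega)]
  · have hram : ∀ Q', Place.LiesOver (KummerTower.step K x n) Q' Q →
        Place.ramificationIndex (KummerTower.step K x n) Q' = Nat.card K - 1 := fun Q' hQ' => by
      rw [key Q' hQ', if_neg (by omega)]
    obtain ⟨Q', hQ'⟩ := Place.exists_liesOver (KummerTower.step K x n) Q
    exact ⟨⟨Q', hQ', by rw [hram Q' hQ']; omega⟩, hram⟩
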